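/- Order $\mathbb{Z}^2$ componentwise and let $\min$ be the componentwise minimum. Say that $X\subseteq\mathbb{Z}^2$ satisfies (G1) if $\min(\alpha,\beta)\in X$ for all $\alpha,\beta\in X$, and (G3) if for all $\alpha\neq\beta$ in $X$ with $\alpha_i=\beta_i$ for some $i\in\{1,2\}$ there is $\epsilon\in X$ with $\epsilon_i>\alpha_i$ and $\epsilon_j\ge\min(\alpha_j,\beta_j)$ for $j\neq i$, with equality if $\alpha_j\ne\beta_j$. A *good semigroup* $S\subseteq\mathbb{N}^2$ is a submonoid satisfying (G1), (G3) and $\delta+\mathbb{N}^2\subseteq S$ for some $\delta\in\mathbb{N}^2$. A *relative good ideal* of $S$ is a nonempty set $E\subseteq\mathbb{Z}^2$ satisfying (G1) and (G3), with $E+S\subseteq E$ and $\alpha+E\subseteq S$ for some $\alpha\in S$. *Distance.* A chain $\alpha=\alpha^{(0)}<\alpha^{(1)}<\dots<\alpha^{(n)}=\beta$ in $E$ has length $n$, and it is saturated if no element of $E$ lies strictly between $\alpha^{(i)}$ and $\alpha^{(i+1)}$, for every $i<n$. Let $d_E(\alpha,\beta)$ be the common length of all saturated chains in $E$ from $\alpha$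 to $\beta$. For relative good ideals $E\supseteq F$ with minimum elements $e(E)$ and $e(F)$, put $d(E\setminus F)=d_E(e(E),\alpha)-d_F(e(F),\alpha)$, where $\alpha$ is any element with $\alpha+\mathbb{N}^2\subseteq E\cap F$. *Levels.* Write $\alpha\le\le\beta$ if $\alpha=\beta$, or $\alpha_1<\beta_1$ and $\alpha_2<\beta_2$. For $A\subseteq\mathbb{Z}^2$ put $D^{(0)}=\emptyset$ and, for $i\ge1$, let $B^{(i)}$ be the set of $\le\le$-maximal elements of $A\setminus\bigcup_{j<i}D^{(j)}$, let $C^{(i)}$ be the set of those $\alpha\in B^{(i)}$ that equal $\min(\beta_1,\beta_2)$ for some $\beta_1,\beta_2\in B^{(i)}\setminus\{\alpha\}$, and put $D^{(i)}=B^{(i)}\setminus C^{(i)}$. If $A$ is the disjoint union of nonempty sets $D^{(1)},\dots,D^{(N)}$, then $\mathrm{NL}(A)=N$ is the number of levels of $A$; the levels are $A_i=D^{(N+1-i)}$, $1\le i\le N$. **Proposition.** Let $I$ be a relative good ideal of a good semigroup $S\subseteq\mathbb{N}^2$, and let $A\subseteq I$ be such that $E=I\setminus A$ is a relative good ideal of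 $S$. Then $\mathrm{NL}(A)$ and $d(I\setminus E)$ are well defined and $$\mathrm{NL}(A)=d(I\setminus E).$$ -/

import Mathlib

/-!  Good semigroups, relative good ideals, distance, and levels.
The ambient lattice is `ℤ^d`, with `ℕ^d` seen inside it as the set of nonnegative vectors;
the order and the minimum `⊓` are componentwise. -/

namespace GoodIdeals

variable {d : ℕ}

/-- (G1): closed under componentwise minimum. -/
def G1 (X : Set (Fin d → ℤ)) : Prop :=
  ∀ α ∈ X, ∀ β ∈ X, α ⊓ β ∈ X

/-- (G2): contains a translate `δ + ℕ^d` with `δ ∈ ℕ^d`. -/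
def G2 (X : Set (Fin d → ℤ)) : Prop :=
  ∃ δ : Fin d → ℤ, 0 ≤ δ ∧ ∀ β, δ ≤ β → β ∈ X

/-- (G3): if two distinct elements share their `i`-th coordinate, then some element has a larger
`i`-th coordinate and the other coordinates at least the minimum, with equality wherever the two
elements differ. -/
def G3 (X : Set (Fin d → ℤ)) : Prop :=
  ∀ α ∈ X, ∀ β ∈ X, α ≠ β → ∀ i, α i = β i →
    ∃ ε ∈ X, α i < ε i ∧
      ∀ j, j ≠ i → min (α j) (β j) ≤ ε j ∧ (α j ≠ β j → ε j = min (α j) (β j))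

/-- A good semigroup: a submonoid of `ℕ^d` with (G1), (G2), (G3). -/
structure IsGoodSemigroup (S : AddSubmonoid (Fin d → ℤ)) : Prop where
  nonneg : ∀ α ∈ S, 0 ≤ α
  g1 : G1 (S : Set (Fin d → ℤ))
  g2 : G2 (S : Set (Fin d → ℤ))
  g3 : G3 (S : Set (Fin d → ℤ))

/-- A relative ideal `E ⊆ ℤ^d` of `S`: nonempty, `E + S ⊆ E`, and `α + E ⊆ S` for some
`α ∈ S`. -/
structure IsRelativeIdeal (S : AddSubmonoid (Fin d → ℤ)) (E : Set (Fin d → ℤ)) : Prop where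
  nonempty : E.Nonempty
  add_mem : ∀ ε ∈ E, ∀ σ ∈ S, ε + σ ∈ E
  exists_translate : ∃ α ∈ S, ∀ ε ∈ E, α + ε ∈ S

/-- A relative good ideal: a relative ideal with (G1) and (G3). -/
structure IsRelativeGoodIdeal (S : AddSubmonoid (Fin d → ℤ)) (E : Set (Fin d → ℤ)) : Prop
    extends IsRelativeIdeal S E where
  g1 : G1 E
  g3 : G3 E

/-- `α < β` are consecutive in `E`. -/
def Consecutive (E : Set (Fin d → ℤ)) (α β : Fin d → ℤ) : Prop :=
  α ∈ E ∧ β ∈ E ∧ α < β ∧ ∀ γ ∈ E, ¬ (α < γ ∧ γ < β)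

/-- `c 0 < c 1 < ⋯ < c n` is a saturated chain of length `n` in `E` from `α` to `β`
(the values `c i` with `n < i` play no role). -/
structure IsSaturatedChain (E : Set (Fin d → ℤ)) (α β : Fin d → ℤ) (n : ℕ)
    (c : ℕ → Fin d → ℤ) : Prop where
  head : c 0 = α
  last : c n = β
  mem : ∀ i ≤ n, c i ∈ E
  consecutive : ∀ i < n, Consecutive E (c i) (c (i + 1))

/-- `d_E(α, β) = n`: saturated chains in `E` from `α` to `β` exist and all have length `n`. -/
def HasChainDist (E : Set (Fin d → ℤ)) (α β : Fin d → ℤ) (n : ℕ) : Prop :=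
  (∃ c, IsSaturatedChain E α β n c) ∧ ∀ m c, IsSaturatedChain E α β m c → m = n

/-- `α` is big enough for `X`: all of `α + ℕ^d` lies in `X`. -/
def BigEnough (X : Set (Fin d → ℤ)) (α : Fin d → ℤ) : Prop :=
  ∀ β, α ≤ β → β ∈ X

/-- `d(E ∖ F) = n`: the sets `E`, `F` have minimum elements `e`, `f`, there are `α` that are
big enough for both, and `d_E(e, α) - d_F(f, α) = n` for every such `α`. -/
def HasDistance (E F : Set (Fin d → ℤ)) (n : ℤ) : Prop :=
  ∃ e f : Fin d → ℤ, IsLeast E e ∧ IsLeast F f ∧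
    (∃ α, BigEnough (E ∩ F) α) ∧
    ∀ α, BigEnough (E ∩ F) α →
      ∃ p q : ℕ, HasChainDist E e α p ∧ HasChainDist F f α q ∧ n = (p : ℤ) - q

/-- `α ≪ β`: strictly smaller in both coordinates. -/
def LL (α β : Fin 2 → ℤ) : Prop := α 0 < β 0 ∧ α 1 < β 1

/-- `α ≤≤ β`: equal or strictly smaller in both coordinates. -/
def LLE (α β : Fin 2 → ℤ) : Prop := α = β ∨ LL α β

/-- The elements of `X` that are maximal with respect to `≤≤`. -/
def maximalPart (X : Set (Fin 2 → ℤ)) : Set (Fin 2 → ℤ) :=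
  {α | α ∈ X ∧ ∀ β ∈ X, LLE α β → β = α}

/-- The elements of `B` that are the componentwise minimum of two other elements of `B`. -/
def minPart (B : Set (Fin 2 → ℤ)) : Set (Fin 2 → ℤ) :=
  {α | α ∈ B ∧ ∃ β₁ ∈ B \ {α}, ∃ β₂ ∈ B \ {α}, α = β₁ ⊓ β₂}

/-- What is left of `A` after the removal of `D⁽¹⁾, …, D⁽ⁱ⁾`. -/
def remaining (A : Set (Fin 2 → ℤ)) : ℕ → Set (Fin 2 → ℤ)
  | 0 => A
  | i + 1 => remaining A i \
      (maximalPart (remaining A i) \ minPart (maximalPart (remaining A i)))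

/-- The sets `D⁽ⁱ⁾ = B⁽ⁱ⁾ ∖ C⁽ⁱ⁾`, where `D⁽⁰⁾ = ∅`, `B⁽ⁱ⁾` is the set of the `≤≤`-maximal
elements of `A ∖ ⋃_{j<i} D⁽ʲ⁾`, and `C⁽ⁱ⁾` is the set of the elements of `B⁽ⁱ⁾` that are the
minimum of two other elements of `B⁽ⁱ⁾`. -/
def D (A : Set (Fin 2 → ℤ)) : ℕ → Set (Fin 2 → ℤ)
  | 0 => ∅
  | i + 1 => maximalPart (remaining A i) \ minPart (maximalPart (remaining A i))

/-- The recursion for `remaining` is the removal of the earlier `D⁽ʲ⁾`. -/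
theorem remaining_eq (A : Set (Fin 2 → ℤ)) (i : ℕ) :
    remaining A i = A \ ⋃ j ∈ Set.Iio (i + 1), D A j := by
  induction i with
  | zero => ext x; simp [remaining, D]
  | succ i ih =>
    have h : remaining A (i + 1) = remaining A i \ D A (i + 1) := rfl
    rw [h, ih]
    ext x
    simp only [Set.mem_sdiff, Set.mem_iUnion, Set.mem_Iio, not_exists]
    constructor
    · rintro ⟨⟨hx, h1⟩, h2⟩
      refine ⟨hx, fun j hj hxj => ?_⟩
      rcases Nat.lt_succ_iff_lt_or_eq.mp hj with hlt | rfl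
      · exact h1 j hlt hxj
      · exact h2 hxj
    · rintro ⟨hx, h1⟩
      exact ⟨⟨hx, fun j hj => h1 j (by omega)⟩, h1 (i + 1) (by omega)⟩

/-- The `i`-th level `A_i = D⁽ᴺ⁺¹⁻ⁱ⁾` of a set with `N` levels, `1 ≤ i ≤ N`. -/
def level (A : Set (Fin 2 → ℤ)) (N i : ℕ) : Set (Fin 2 → ℤ) := D A (N + 1 - i)

/-- `NL(A) = N`: the levels `A_1, …, A_N` form a partition of `A` (into nonempty sets). -/
structure HasNumLevels (A : Set (Fin 2 → ℤ)) (N : ℕ) : Prop where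
  union : A = ⋃ i ∈ Set.Icc 1 N, level A N i
  disjoint : (Set.Icc 1 N).PairwiseDisjoint (level A N)
  nonempty : ∀ i ∈ Set.Icc 1 N, (level A N i).Nonempty

/-- The number of levels is determined by `A`. -/
theorem HasNumLevels.unique {A : Set (Fin 2 → ℤ)} {M N : ℕ}
    (hM : HasNumLevels A M) (hN : HasNumLevels A N) : M = N := by
  have key : ∀ M N : ℕ, HasNumLevels A M → HasNumLevels A N → ¬ M < N := by
    intro M N hM hN hlt
    obtain ⟨x, hx⟩ := hN.nonempty (N - M) ⟨by omega, by omega⟩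
    have hx' : x ∈ D A (M + 1) := by
      have : N + 1 - (N - M) = M + 1 := by omega
      simpa [level, this] using hx
    have hr : x ∈ remaining A M := hx'.1.1
    rw [remaining_eq] at hr
    have hxA := hr.1
    rw [hM.union] at hxA
    simp only [Set.mem_iUnion] at hxA
    obtain ⟨i, ⟨hi1, _⟩, hxi⟩ := hxA
    exact hr.2 (Set.mem_biUnion (show M + 1 - i ∈ Set.Iio (M + 1) by
      simp only [Set.mem_Iio]; omega) hxi)
  exact le_antisymm (not_lt.mp (key N M hN hM)) (not_lt.mp (key M N hM hN))

/-- The distance is determined by `E` and `F`. -/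
theorem HasDistance.unique {E F : Set (Fin d → ℤ)} {m n : ℤ}
    (hm : HasDistance E F m) (hn : HasDistance E F n) : m = n := by
  obtain ⟨e, f, he, hf, ⟨α, hα⟩, h⟩ := hm
  obtain ⟨e', f', he', hf', -, h'⟩ := hn
  obtain rfl := he.unique he'
  obtain rfl := hf.unique hf'
  obtain ⟨p, q, ⟨⟨c, hc⟩, -⟩, ⟨⟨b, hb⟩, -⟩, rfl⟩ := h α hα
  obtain ⟨p', q', hp, hq, rfl⟩ := h' α hα
  rw [hp.2 p c hc, hq.2 q b hb]

end GoodIdeals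

namespace GoodIdeals

/-! Let a set count a lattice step when the ray leaving the step's starting point perpendicular to
it (upward for a step to the right, rightward for a step up) meets the set. By (G3) both ways round
a unit square count equally (`PlaneGood.square`), so the count from a base point depends only on the
endpoint: this is `potential`. By (G1) it grows by exactly one between consecutive elements
(`PlaneGood.potential_consecutive`), so it measures saturated chains, which therefore have a common
length.

Comparing the potentials of I and E gives n(x, y), the number of steps from (x, y) to a far point
whose ray meets I but not E. Its value at the minimum of I is d(I ∖ E), because the potential of E
vanishes at the minimum of E.

On the other side, D⁽ᵏ⁾ is the set of points of A where n = k (`IsGapPotential.remaining_D`). By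
(G1) for E, one of the two rays from a point of A avoids E, so n drops strictly towards the upper
right, and no point of A is the minimum of two others with its own value of n. Conversely, n drops
by at most two across a unit square, so a point whose value is too large is not maximal or is such a
minimum (`IsGapPotential.exists_of_lt`). All values from 1 to n at the minimum of I occur on A, so
that number is NL(A). -/

/-- (G1) and (G3) for a subset of `ℤ²`, written in coordinates. -/
structure PlaneGood (P : ℤ → ℤ → Prop) : Prop where
  inf : ∀ {a b c d}, P a b → P c d → P (min a c) (min b d)
  col : ∀ {a b y}, P a b → P a y → b < y → ∃ x, a < x ∧ P x b
  row : ∀ {a b x}, P a b → P x b → a < x → ∃ y, b < y ∧ P a y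

theorem PlaneGood.swap {P : ℤ → ℤ → Prop} (h : PlaneGood P) : PlaneGood (Function.swap P) where
  inf h₁ h₂ := h.inf h₁ h₂
  col h₁ h₂ := h.row h₁ h₂
  row h₁ h₂ := h.col h₁ h₂

/-- The usual form of (G1) below: a point on the ray to the right and a point on the ray upward
force their common origin into the set. -/
theorem PlaneGood.left {P : ℤ → ℤ → Prop} (h : PlaneGood P) {x y x' y' : ℤ}
    (h₁ : P x' y) (h₂ : P x y') (hx : x ≤ x') (hy : y ≤ y') : P x y := by
  simpa [hx, hy] using h.inf h₁ h₂

/-! ### Ray indicators and the lattice-path potential -/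

open Classical in
/-- `1` if the vertical ray going up from `(x, y)` meets the set, and `0` otherwise. -/
noncomputable def colInd (P : ℤ → ℤ → Prop) (x y : ℤ) : ℤ := if ∃ z, y ≤ z ∧ P x z then 1 else 0

theorem colInd_eq_one {P : ℤ → ℤ → Prop} {x y z : ℤ} (hz : y ≤ z) (h : P x z) :
    colInd P x y = 1 := if_pos ⟨z, hz, h⟩

theorem colInd_eq_zero {P : ℤ → ℤ → Prop} {x y : ℤ} (h : ∀ z, y ≤ z → ¬ P x z) :
    colInd P x y = 0 := if_neg fun ⟨z, hz, hP⟩ => h z hz hP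

theorem colInd_succ {P : ℤ → ℤ → Prop} {x y : ℤ} (h : ¬ P x y) :
    colInd P x (y + 1) = colInd P x y := by
  by_cases h' : ∃ z, y ≤ z ∧ P x z
  · obtain ⟨z, hz, hP⟩ := h'
    have : y ≠ z := by rintro rfl; exact h hP
    rw [colInd_eq_one hz hP, colInd_eq_one (by omega) hP]
  · push Not at h'
    rw [colInd_eq_zero h', colInd_eq_zero fun z hz => h' z (by omega)]

/-- Going round a unit square, right and up counts as much as up and right. -/
theorem PlaneGood.square {P : ℤ → ℤ → Prop} (h : PlaneGood P) (x y : ℤ) :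
    colInd P x y + colInd (Function.swap P) y (x + 1)
      = colInd (Function.swap P) y x + colInd P x (y + 1) := by
  by_cases hP : P x y
  · rw [colInd_eq_one le_rfl hP, colInd_eq_one (P := Function.swap P) le_rfl hP]
    -- The two sides leaving `(x, y)` count one; (G3) makes the opposite two agree.
    congr 1
    by_cases h' : ∃ z, y + 1 ≤ z ∧ P x z
    · obtain ⟨z, hz, hz'⟩ := h'
      obtain ⟨w, hw, hw'⟩ := h.col hP hz' (by omega)
      rw [colInd_eq_one hz hz', colInd_eq_one (P := Function.swap P) (z := w) (by omega) hw']
    · push Not at h'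
      rw [colInd_eq_zero h', colInd_eq_zero]
      intro w hw hw'
      obtain ⟨z, hz, hz'⟩ := h.row hP hw' (by omega)
      exact h' z (by omega) hz'
  -- Off the set, removing the origin from a ray changes nothing, so parallel sides count equally.
  · rw [colInd_succ hP, colInd_succ (P := Function.swap P) hP, add_comm]

/-- The number of steps of a lattice path from `(b, c)` to `(x, y)` whose ray meets the set. -/
noncomputable def potential (P : ℤ → ℤ → Prop) (b c x y : ℤ) : ℤ :=
  ∑ t ∈ Finset.range (x - b).toNat, colInd P (b + t) c
    + ∑ s ∈ Finset.range (y - c).toNat, colInd (Function.swap P) (c + s) x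

theorem potential_base (P : ℤ → ℤ → Prop) (b c : ℤ) : potential P b c b c = 0 := by
  simp [potential]

theorem potential_up (P : ℤ → ℤ → Prop) (b c x : ℤ) {y : ℤ} (hy : c ≤ y) :
    potential P b c x (y + 1) = potential P b c x y + colInd (Function.swap P) y x := by
  have h : (y + 1 - c).toNat = (y - c).toNat + 1 := by omega
  have h' : c + ((y - c).toNat : ℤ) = y := by omega
  simp only [potential, h, Finset.sum_range_succ, h']
  ring

/-- The path in `potential` runs right at height `c`, then up. Moving the endpoint right displaces
the whole vertical leg, and the square law carries the change up row by row. -/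
theorem PlaneGood.potential_right {P : ℤ → ℤ → Prop} (h : PlaneGood P) {b c x y : ℤ}
    (hx : b ≤ x) (hy : c ≤ y) :
    potential P b c (x + 1) y = potential P b c x y + colInd P x y := by
  induction y, hy using Int.leInduction with
  | base =>
    have h : (x + 1 - b).toNat = (x - b).toNat + 1 := by omega
    have h' : b + ((x - b).toNat : ℤ) = x := by omega
    simp only [potential, h, Finset.sum_range_succ, h', sub_self, Int.toNat_zero,
      Finset.range_zero, Finset.sum_empty, add_zero]
  | succ y hy ih =>
    rw [potential_up P b c _ hy, potential_up P b c _ hy, ih]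
    linarith [h.square x y]

/-- Constancy on a segment of integers. -/
theorem eq_of_forall_succ_eq {f : ℤ → ℤ} {a b : ℤ} (hab : a ≤ b)
    (h : ∀ t, a ≤ t → t < b → f (t + 1) = f t) : f b = f a := by
  induction b, hab using Int.leInduction with
  | base => rfl
  | succ b hb ih =>
    rw [h b hb (by omega), ih fun t ht ht' => h t ht (by omega)]

/-! ### The potential along consecutive elements -/

/-- The potential increases by one between two consecutive elements. -/
theorem PlaneGood.potential_consecutive {P : ℤ → ℤ → Prop} (h : PlaneGood P)
    {b c x y x' y' : ℤ} (hx : b ≤ x) (hy : c ≤ y) (hP : P x y) (hP' : P x' y') (hxx : x ≤ x')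
    (hyy : y ≤ y') (hne : x < x' ∨ y < y')
    (hcons : ∀ u v, P u v → x ≤ u → u ≤ x' → y ≤ v → v ≤ y' → (x < u ∨ y < v) →
      (u < x' ∨ v < y') → False) :
    potential P b c x' y' = potential P b c x y + 1 := by
  have hup : ∀ t, y ≤ t → t < y' → (x < x' ∨ y < t) →
      potential P b c x' (t + 1) = potential P b c x' t := by
    intro t ht ht' hlt
    rw [potential_up P b c x' (by omega), colInd_eq_zero, add_zero]
    intro u hu hPu
    exact hcons x' t (h.left hPu hP' hu ht'.le) hxx le_rfl ht ht'.le hlt (Or.inr ht')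
  -- Go right at height `y`, then up at `x'`. Only the first step counts: a later ray meeting the
  -- set would, after a minimum with `(x', y')`, give an element strictly between.
  rcases hxx.lt_or_eq with hlt | rfl
  · have h₁ : potential P b c x' y' = potential P b c x' y :=
      eq_of_forall_succ_eq hyy fun t ht ht' => hup t ht ht' (Or.inl hlt)
    have h₂ : potential P b c x' y = potential P b c (x + 1) y := by
      refine eq_of_forall_succ_eq (f := fun t => potential P b c t y) (by omega) fun t ht ht' => ?_
      rw [h.potential_right (by omega) hy, colInd_eq_zero, add_zero]
      intro s hs hPs
      have := h.inf hPs hP'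
      rw [min_eq_left ht'.le] at this
      exact hcons t _ this (by omega) ht'.le (by omega) (by omega) (by omega) (by omega)
    rw [h₁, h₂, h.potential_right hx hy, colInd_eq_one le_rfl hP]
  · have hlt : y < y' := by omega
    have h₁ : potential P b c x y' = potential P b c x (y + 1) :=
      eq_of_forall_succ_eq (f := fun t => potential P b c x t) (by omega)
        fun t ht ht' => hup t (by omega) ht' (by omega)
    rw [h₁, potential_up P b c x hy, colInd_eq_one (P := Function.swap P) le_rfl hP]

/-- Below both coordinates of a minimum the potential vanishes. -/
theorem PlaneGood.potential_least {P : ℤ → ℤ → Prop} (h : PlaneGood P) {b c x y : ℤ}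
    (hx : b ≤ x) (hy : c ≤ y) (hlow : ∀ u v, P u v → x ≤ u ∧ y ≤ v) :
    potential P b c x y = 0 := by
  have h₁ : potential P b c x y = potential P b c x c := by
    refine eq_of_forall_succ_eq hy fun t ht ht' => ?_
    rw [potential_up P b c x ht, colInd_eq_zero, add_zero]
    intro u _ hu
    exact absurd (hlow _ _ hu).2 (by omega)
  have h₂ : potential P b c x c = potential P b c b c := by
    refine eq_of_forall_succ_eq (f := fun t => potential P b c t c) hx fun t ht ht' => ?_
    rw [h.potential_right ht le_rfl, colInd_eq_zero, add_zero]
    intro u _ hu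
    exact absurd (hlow _ _ hu).1 (by omega)
  rw [h₁, h₂, potential_base]

/-! ### Gap potentials: steps whose ray meets `P` but not `Q` -/

open Function (swap)

open Classical in
/-- `1` if the vertical ray going up from `(x, y)` meets `P` but not `Q`, and `0` otherwise. -/
noncomputable def gap (P Q : ℤ → ℤ → Prop) (x y : ℤ) : ℤ :=
  if (∃ z, y ≤ z ∧ P x z) ∧ ∀ z, y ≤ z → ¬ Q x z then 1 else 0

theorem gap_nonneg (P Q : ℤ → ℤ → Prop) (x y : ℤ) : 0 ≤ gap P Q x y := by
  unfold gap; split_ifs <;> norm_num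

theorem gap_le_one (P Q : ℤ → ℤ → Prop) (x y : ℤ) : gap P Q x y ≤ 1 := by
  unfold gap; split_ifs <;> norm_num

theorem gap_pos_iff {P Q : ℤ → ℤ → Prop} {x y : ℤ} :
    0 < gap P Q x y ↔ (∃ z, y ≤ z ∧ P x z) ∧ ∀ z, y ≤ z → ¬ Q x z := by
  unfold gap
  split_ifs with h
  · exact iff_of_true one_pos h
  · exact iff_of_false (lt_irrefl 0) h

theorem gap_eq_zero_of_mem {P Q : ℤ → ℤ → Prop} {x y z : ℤ} (hz : y ≤ z) (h : Q x z) :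
    gap P Q x y = 0 := if_neg fun h' => h'.2 z hz h

theorem gap_eq_sub {P Q : ℤ → ℤ → Prop} (hQP : ∀ x y, Q x y → P x y) (x y : ℤ) :
    gap P Q x y = colInd P x y - colInd Q x y := by
  by_cases hQ : ∃ z, y ≤ z ∧ Q x z
  · obtain ⟨z, hz, h⟩ := hQ
    rw [gap_eq_zero_of_mem hz h, colInd_eq_one hz h, colInd_eq_one hz (hQP _ _ h), sub_self]
  · push Not at hQ
    rw [colInd_eq_zero hQ, sub_zero]
    by_cases hP : ∃ z, y ≤ z ∧ P x z
    · rw [gap, if_pos ⟨hP, hQ⟩, colInd, if_pos hP]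
    · rw [gap, if_neg fun h => hP h.1, colInd, if_neg hP]

/-- `n x y` is the number of steps, on any lattice path from `(x, y)` to `(d, e)`, whose ray
meets `P` but not `Q`. -/
structure IsGapPotential (P Q : ℤ → ℤ → Prop) (b c d e : ℤ) (n : ℤ → ℤ → ℤ) : Prop where
  base : ∀ {x y}, P x y → b ≤ x ∧ c ≤ y
  sub : ∀ {x y}, Q x y → P x y
  good : PlaneGood P
  good' : PlaneGood Q
  big : ∀ {x y}, d ≤ x → e ≤ y → Q x y
  right : ∀ {x y}, b ≤ x → c ≤ y → n x y = n (x + 1) y + gap P Q x y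
  up : ∀ {x y}, b ≤ x → c ≤ y → n x y = n x (y + 1) + gap (swap P) (swap Q) y x
  zero : n d e = 0

namespace IsGapPotential

variable {P Q : ℤ → ℤ → Prop} {b c d e : ℤ} {n : ℤ → ℤ → ℤ}

/-- Reflection in the diagonal, which turns statements on right steps into statements on up steps.
-/
theorem swap (h : IsGapPotential P Q b c d e n) :
    IsGapPotential (swap P) (swap Q) c b e d (swap n) where
  base hP := (h.base hP).symm
  sub hQ := h.sub hQ
  good := h.good.swap
  good' := h.good'.swap
  big hx hy := h.big hy hx
  right hx hy := h.up hy hx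
  up hx hy := h.right hy hx
  zero := h.zero

theorem anti_right (h : IsGapPotential P Q b c d e n) {x x' y : ℤ} (hx : b ≤ x) (hy : c ≤ y)
    (hxx : x ≤ x') : n x' y ≤ n x y := by
  induction x', hxx using Int.leInduction with
  | base => rfl
  | succ t ht ih =>
    have := h.right (x := t) (by omega) hy
    have := gap_nonneg P Q t y
    omega

theorem anti_up (h : IsGapPotential P Q b c d e n) {x y y' : ℤ} (hx : b ≤ x) (hy : c ≤ y)
    (hyy : y ≤ y') : n x y' ≤ n x y := h.swap.anti_right hy hx hyy

theorem anti (h : IsGapPotential P Q b c d e n) {x x' y y' : ℤ} (hx : b ≤ x) (hy : c ≤ y)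
    (hxx : x ≤ x') (hyy : y ≤ y') : n x' y' ≤ n x y :=
  (h.anti_up (by omega) hy hyy).trans (h.anti_right hx hy hxx)

theorem const_right (h : IsGapPotential P Q b c d e n) {x x' y : ℤ} (hx : d ≤ x) (hy : c ≤ y)
    (hxx : x ≤ x') : n x' y = n x y := by
  have hb := (h.base (h.sub (h.big le_rfl le_rfl))).1
  refine eq_of_forall_succ_eq (f := fun t => n t y) hxx fun t ht ht' => ?_
  have h₁ := h.right (x := t) (by omega) hy
  rw [gap_eq_zero_of_mem (z := max y e) (by omega) (h.big (by omega) (by omega))] at h₁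
  omega

theorem const_up (h : IsGapPotential P Q b c d e n) {x y y' : ℤ} (hx : b ≤ x) (hy : e ≤ y)
    (hyy : y ≤ y') : n x y' = n x y := h.swap.const_right hy hx hyy

theorem eq_zero (h : IsGapPotential P Q b c d e n) {x y : ℤ} (hx : d ≤ x) (hy : e ≤ y) :
    n x y = 0 := by
  have hb := h.base (h.sub (h.big le_rfl le_rfl))
  rw [h.const_right le_rfl (by omega) hx, h.const_up (by omega) le_rfl hy, h.zero]

theorem nonneg (h : IsGapPotential P Q b c d e n) {x y : ℤ} (hx : b ≤ x) (hy : c ≤ y) :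
    0 ≤ n x y := by
  rw [← h.eq_zero (x := max x d) (y := max y e) (by omega) (by omega)]
  exact h.anti hx hy (by omega) (by omega)

/-- From height `e` on, `n` is constant along a column, so any point of `P` on the ray has the
required value. -/
theorem exists_col (h : IsGapPotential P Q b c d e n) {x y : ℤ} (hx : b ≤ x)
    (hye : e ≤ y) (hgap : 0 < gap P Q x y) :
    ∃ x' y', x ≤ x' ∧ y ≤ y' ∧ P x' y' ∧ ¬ Q x' y' ∧ n x' y' = n x y := by
  obtain ⟨⟨z, hz, hP⟩, hQ⟩ := gap_pos_iff.1 hgap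
  exact ⟨x, z, le_rfl, hz, hP, hQ z hz, h.const_up hx hye hz⟩

/-- Every positive value of the potential is attained, further up, at a point of `P ∖ Q`. -/
theorem exists_eq (h : IsGapPotential P Q b c d e n) {x y : ℤ} (hx : b ≤ x) (hy : c ≤ y)
    (hn : 0 < n x y) : ∃ x' y', x ≤ x' ∧ y ≤ y' ∧ P x' y' ∧ ¬ Q x' y' ∧ n x' y' = n x y := by
  induction hm : (d - x).toNat + (e - y).toNat using Nat.strong_induction_on generalizing x y with
  | _ m ih =>
    have h₁ := h.right hx hy
    have h₂ := h.up hx hy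
    have hg₁ := gap_nonneg P Q x y
    have hg₂ := gap_nonneg (Function.swap P) (Function.swap Q) y x
    -- Move right or up while the value is kept; staying short of `(d, e)` makes the measure
    -- decrease.
    by_cases c₁ : x < d ∧ n (x + 1) y = n x y
    · obtain ⟨x', y', hx', hy', hP, hQ, hn'⟩ :=
        ih _ (by omega) (x := x + 1) (y := y) (by omega) hy (by omega) rfl
      exact ⟨x', y', by omega, hy', hP, hQ, by omega⟩
    by_cases c₂ : y < e ∧ n x (y + 1) = n x y
    · obtain ⟨x', y', hx', hy', hP, hQ, hn'⟩ :=
        ih _ (by omega) (x := x) (y := y + 1) hx (by omega) (by omega) rfl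
      exact ⟨x', y', hx', by omega, hP, hQ, by omega⟩
    rcases lt_or_ge x d with hxd | hxd
    · have hp₁ : 0 < gap P Q x y := by omega
      rcases lt_or_ge y e with hye | hye
      -- Both unit steps lower `n`, so both rays meet `P`, and (G1) puts their origin in `P`.
      · have hp₂ : 0 < gap (Function.swap P) (Function.swap Q) y x := by omega
        obtain ⟨⟨z, hz, hPz⟩, hQ⟩ := gap_pos_iff.1 hp₁
        obtain ⟨⟨w, hw, hPw⟩, -⟩ := gap_pos_iff.1 hp₂
        exact ⟨x, y, le_rfl, le_rfl, h.good.left hPw hPz hw hz, hQ y le_rfl, rfl⟩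
      · exact h.exists_col hx hye hp₁
    · rcases lt_or_ge y e with hye | hye
      · obtain ⟨y', x', hy', hx', hP, hQ, hn'⟩ :=
          h.swap.exists_col hy hxd (by omega)
        exact ⟨x', y', hx', hy', hP, hQ, hn'⟩
      · exact absurd (h.eq_zero hxd hye) (by omega)

/-- At a point of `P ∖ Q`, one of the two rays avoids `Q`. -/
theorem gap_pos_or (h : IsGapPotential P Q b c d e n) {x y : ℤ} (hP : P x y) (hQ : ¬ Q x y) :
    0 < gap P Q x y ∨ 0 < gap (Function.swap P) (Function.swap Q) y x := by
  simp only [gap_pos_iff]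
  by_contra! hcon
  obtain ⟨z, hz, hQz⟩ := hcon.1 ⟨y, le_rfl, hP⟩
  obtain ⟨w, hw, hQw⟩ := hcon.2 ⟨x, le_rfl, hP⟩
  exact hQ (h.good'.left hQw hQz hw hz)

theorem lt_of_lt (h : IsGapPotential P Q b c d e n) {x y x' y' : ℤ} (hP : P x y) (hQ : ¬ Q x y)
    (hx : x < x') (hy : y < y') : n x' y' < n x y := by
  obtain ⟨hb, hc⟩ := h.base hP
  have h₁ := h.right hb hc
  have h₂ := h.up hb hc
  -- The target lies beyond both unit steps, so the one with positive gap already forces the drop.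
  have h₃ := h.anti (x := x + 1) (x' := x') (y := y) (y' := y') (by omega) hc (by omega) hy.le
  have h₄ := h.anti (x := x) (x' := x') (y := y + 1) (y' := y') hb (by omega) hx.le (by omega)
  have := h.gap_pos_or hP hQ
  omega

theorem pos (h : IsGapPotential P Q b c d e n) {x y : ℤ} (hP : P x y) (hQ : ¬ Q x y) :
    0 < n x y := by
  obtain ⟨hb, hc⟩ := h.base hP
  exact (h.nonneg (x := x + 1) (y := y + 1) (by omega) (by omega)).trans_lt
    (h.lt_of_lt hP hQ (by omega) (by omega))

/-- A point of `P ∖ Q` is not the minimum of two points of `P ∖ Q` of the same potential. -/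
theorem false_of_inf (h : IsGapPotential P Q b c d e n) {x y x' y' : ℤ} (hP : P x y)
    (hQ : ¬ Q x y) (hx : x < x') (hy : y < y') (h₁ : n x y ≤ n x' y) (h₂ : n x y ≤ n x y') :
    False := by
  obtain ⟨hb, hc⟩ := h.base hP
  have h₃ := h.right hb hc
  have h₄ := h.up hb hc
  have h₅ := h.anti_right (x := x + 1) (x' := x') (by omega) hc (by omega)
  have h₆ := h.anti_up (y := y + 1) (y' := y') hb (by omega) (by omega)
  have := h.gap_pos_or hP hQ
  omega

/-- If a ray avoids `Q` and its first point beyond the origin exists, the potential there is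
one more than at the opposite corner of the unit square. -/
theorem exists_row (h : IsGapPotential P Q b c d e n) {x y : ℤ} (hx : b ≤ x) (hy : c ≤ y)
    (hgap : 0 < gap (Function.swap P) (Function.swap Q) y (x + 1)) :
    ∃ w, x < w ∧ P w y ∧ ¬ Q w y ∧ n (x + 1) (y + 1) + 1 = n w y := by
  obtain ⟨hex, hQ⟩ := gap_pos_iff.1 hgap
  obtain ⟨w, ⟨hw, hP⟩, hmin⟩ := Int.exists_least_of_bdd ⟨x + 1, fun z hz => hz.1⟩ hex
  have hxw : x < w := by omega
  have h₁ : n w (y + 1) = n (x + 1) (y + 1) := by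
    refine eq_of_forall_succ_eq (f := fun t => n t (y + 1)) hw fun t ht ht' => ?_
    have h₂ := h.right (x := t) (y := y + 1) (by omega) (by omega)
    -- A point of `P` above `(t, y + 1)` and `(w, y)` would have minimum `(t, y)`, contradicting the
    -- choice of `w`.
    have h₃ : ¬ 0 < gap P Q t (y + 1) := by
      intro hpos
      obtain ⟨⟨z, hz, hPz⟩, -⟩ := gap_pos_iff.1 hpos
      have := hmin t ⟨ht, h.good.left hP hPz ht'.le (by omega)⟩
      omega
    have := gap_nonneg P Q t (y + 1)
    omega
  have h₂ := h.up (x := w) (y := y) (by omega) hy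
  have h₃ : 0 < gap (Function.swap P) (Function.swap Q) y w :=
    gap_pos_iff.2 ⟨⟨w, le_rfl, hP⟩, fun z hz => hQ z (by omega)⟩
  have := gap_le_one (Function.swap P) (Function.swap Q) y w
  exact ⟨w, hxw, hP, hQ w hw, by omega⟩

/-- A point of `P ∖ Q` of potential larger than `k` lies strictly below a point of `P ∖ Q` of
potential at least `k`, or is the minimum of two such points. -/
theorem exists_of_lt (h : IsGapPotential P Q b c d e n) {x y k : ℤ} (hP : P x y)
    (hk : 0 < k) (hn : k < n x y) :
    (∃ x' y', x < x' ∧ y < y' ∧ P x' y' ∧ ¬ Q x' y' ∧ k ≤ n x' y') ∨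
    ∃ x' y', x < x' ∧ y < y' ∧ (P x' y ∧ ¬ Q x' y ∧ k ≤ n x' y) ∧
      (P x y' ∧ ¬ Q x y' ∧ k ≤ n x y') := by
  obtain ⟨hb, hc⟩ := h.base hP
  rcases le_or_gt k (n (x + 1) (y + 1)) with hle | hlt
  · obtain ⟨x', y', hx, hy, hP', hQ', hn'⟩ :=
      h.exists_eq (x := x + 1) (y := y + 1) (by omega) (by omega) (by omega)
    exact Or.inl ⟨x', y', by omega, by omega, hP', hQ', by omega⟩
  -- Across the square `n` drops by at least two, hence exactly two: all four sides count and `n (x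
  -- + 1) (y + 1) = k - 1`.
  · have h₁ := h.right hb hc
    have h₂ := h.up hb hc
    have h₃ := h.right (x := x) (y := y + 1) hb (by omega)
    have h₄ := h.up (x := x + 1) (y := y) (by omega) hc
    have := gap_le_one P Q x y
    have := gap_le_one P Q x (y + 1)
    have := gap_le_one (Function.swap P) (Function.swap Q) y x
    have := gap_le_one (Function.swap P) (Function.swap Q) y (x + 1)
    obtain ⟨w, hw, hPw, hQw, hnw⟩ := h.exists_row hb hc (by omega)
    obtain ⟨z, hz, hPz, hQz, hnz⟩ := h.swap.exists_row hc hb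
      (show 0 < gap P Q x (y + 1) by omega)
    have hnz' : n (x + 1) (y + 1) + 1 = n x z := hnz
    exact Or.inr ⟨w, z, hw, hz, ⟨hPw, hQw, by omega⟩, hPz, hQz, by omega⟩

/-- The potential takes all values between `0` and its value at a point. -/
theorem exists_value (h : IsGapPotential P Q b c d e n) {x y k : ℤ} (hx : b ≤ x) (hy : c ≤ y)
    (hk : 0 ≤ k) (hn : k ≤ n x y) : ∃ x' y', x ≤ x' ∧ y ≤ y' ∧ n x' y' = k := by
  induction hm : (n x y - k).toNat generalizing x y with
  | zero => exact ⟨x, y, le_rfl, le_rfl, by omega⟩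
  | succ m ih =>
    -- From a point of `P ∖ Q` with the same value, some unit step lowers `n` by exactly one.
    obtain ⟨x', y', hx', hy', hP, hQ, hn'⟩ := h.exists_eq hx hy (by omega)
    have h₁ := h.right (x := x') (y := y') (by omega) (by omega)
    have h₂ := h.up (x := x') (y := y') (by omega) (by omega)
    have := gap_le_one P Q x' y'
    have := gap_le_one (Function.swap P) (Function.swap Q) y' x'
    rcases h.gap_pos_or hP hQ with hg | hg
    · obtain ⟨u, v, hu, hv, hk'⟩ :=
        ih (x := x' + 1) (y := y') (by omega) (by omega) (by omega) (by omega)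
      exact ⟨u, v, by omega, by omega, hk'⟩
    · obtain ⟨u, v, hu, hv, hk'⟩ :=
        ih (x := x') (y := y' + 1) (by omega) (by omega) (by omega) (by omega)
      exact ⟨u, v, by omega, by omega, hk'⟩

end IsGapPotential

/-! ### From subsets of `ℤ²` to relations; minima and conductors -/

/-- Membership in a subset of `ℤ²`, as a relation between the coordinates. -/
def plane (X : Set (Fin 2 → ℤ)) (x y : ℤ) : Prop := ![x, y] ∈ X

theorem vec_eta (α : Fin 2 → ℤ) : ![α 0, α 1] = α := by
  ext i; fin_cases i <;> rfl

theorem plane_iff {X : Set (Fin 2 → ℤ)} {α : Fin 2 → ℤ} : plane X (α 0) (α 1) ↔ α ∈ X := by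
  rw [plane, vec_eta]

theorem le_iff_two {α β : Fin 2 → ℤ} : α ≤ β ↔ α 0 ≤ β 0 ∧ α 1 ≤ β 1 := by
  rw [Pi.le_def, Fin.forall_fin_two]

theorem eq_iff_two {α β : Fin 2 → ℤ} : α = β ↔ α 0 = β 0 ∧ α 1 = β 1 := by
  rw [funext_iff, Fin.forall_fin_two]

theorem lt_iff_two {α β : Fin 2 → ℤ} :
    α < β ↔ (α 0 ≤ β 0 ∧ α 1 ≤ β 1) ∧ (α 0 < β 0 ∨ α 1 < β 1) := by
  rw [lt_iff_le_not_ge, le_iff_two, le_iff_two]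
  omega

theorem planeGood {X : Set (Fin 2 → ℤ)} (h₁ : G1 X) (h₃ : G3 X) : PlaneGood (plane X) where
  inf {a b c d} hα hβ := by
    have h := h₁ _ hα _ hβ
    rwa [← plane_iff] at h
  col {a b y} hα hβ hlt := by
    obtain ⟨ε, hε, hlt', hj⟩ := h₃ _ hα _ hβ (fun h => hlt.ne (congrFun h 1)) 0 rfl
    have h := (hj 1 (by decide)).2 hlt.ne
    simp only [Matrix.cons_val_zero, Matrix.cons_val_one, min_eq_left hlt.le] at h hlt'
    exact ⟨ε 0, hlt', h ▸ plane_iff.2 hε⟩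
  row {a b x} hα hβ hlt := by
    obtain ⟨ε, hε, hlt', hj⟩ := h₃ _ hα _ hβ (fun h => hlt.ne (congrFun h 0)) 1 rfl
    have h := (hj 0 (by decide)).2 hlt.ne
    simp only [Matrix.cons_val_zero, Matrix.cons_val_one, min_eq_left hlt.le] at h hlt'
    exact ⟨ε 1, hlt', h ▸ plane_iff.2 hε⟩

/-- A nonempty set with (G1) that is bounded below has a minimum. -/
theorem exists_isLeast {X : Set (Fin 2 → ℤ)} (h₁ : G1 X) (hne : X.Nonempty) (hb : BddBelow X) :
    ∃ e, IsLeast X e := by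
  obtain ⟨α, hα⟩ := hne
  obtain ⟨b, hb⟩ := hb
  have key : ∀ i : Fin 2, ∃ β ∈ X, ∀ γ ∈ X, β i ≤ γ i := by
    intro i
    obtain ⟨_, ⟨β, hβ, rfl⟩, hmin⟩ := Int.exists_least_of_bdd (P := fun z => ∃ β ∈ X, β i = z)
      ⟨b i, by rintro z ⟨β, hβ, rfl⟩; exact hb hβ i⟩ ⟨_, α, hα, rfl⟩
    exact ⟨β, hβ, fun γ hγ => hmin _ ⟨γ, hγ, rfl⟩⟩
  obtain ⟨β, hβ, hβm⟩ := key 0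
  obtain ⟨γ, hγ, hγm⟩ := key 1
  refine ⟨β ⊓ γ, h₁ _ hβ _ hγ, fun δ hδ => le_iff_two.2 ⟨?_, ?_⟩⟩
  · exact inf_le_left.trans (hβm δ hδ)
  · exact inf_le_right.trans (hγm δ hδ)

theorem IsRelativeIdeal.bddBelow {S : AddSubmonoid (Fin 2 → ℤ)} (hS : IsGoodSemigroup S)
    {E : Set (Fin 2 → ℤ)} (hE : IsRelativeIdeal S E) : BddBelow E := by
  obtain ⟨α, -, hα⟩ := hE.exists_translate
  exact ⟨-α, fun ε hε => neg_le_iff_add_nonneg'.2 (hS.nonneg _ (hα ε hε))⟩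

theorem IsRelativeIdeal.exists_bigEnough {S : AddSubmonoid (Fin 2 → ℤ)} (hS : IsGoodSemigroup S)
    {E : Set (Fin 2 → ℤ)} (hE : IsRelativeIdeal S E) : ∃ α, BigEnough E α := by
  obtain ⟨ε, hε⟩ := hE.nonempty
  obtain ⟨δ, -, hδ⟩ := hS.g2
  refine ⟨ε + δ, fun β hβ => ?_⟩
  have h := hE.add_mem ε hε (β - ε) (hδ _ (le_sub_iff_add_le'.2 hβ))
  rwa [add_sub_cancel] at h

/-! ### Existence and length of saturated chains -/

theorem IsSaturatedChain.cons {d : ℕ} {E : Set (Fin d → ℤ)} {α β γ : Fin d → ℤ} {n : ℕ}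
    {c : ℕ → Fin d → ℤ} (hc : IsSaturatedChain E β γ n c) (h : Consecutive E α β) :
    IsSaturatedChain E α γ (n + 1) (fun i => Nat.casesOn i α c) where
  head := rfl
  last := hc.last
  mem i hi := by
    cases i with
    | zero => exact h.1
    | succ i => exact hc.mem i (by omega)
  consecutive i hi := by
    cases i with
    | zero => simpa [hc.head] using h
    | succ i => exact hc.consecutive i (by omega)

theorem exists_isSaturatedChain (X : Set (Fin 2 → ℤ)) {α β : Fin 2 → ℤ} (hα : α ∈ X)
    (hβ : β ∈ X) (hle : α ≤ β) : ∃ n c, IsSaturatedChain X α β n c := by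
  induction hm : (β 0 - α 0).toNat + (β 1 - α 1).toNat using Nat.strong_induction_on
    generalizing α with
  | _ m ih =>
    rcases hle.eq_or_lt with rfl | hlt
    · exact ⟨0, fun _ => α, rfl, rfl, fun _ _ => hα, fun i hi => absurd hi (by omega)⟩
    -- An element of `(α, β]` nearest to `α` in the ℓ¹ distance is consecutive to `α`.
    · obtain ⟨γ, ⟨hγ, hαγ, hγβ⟩, hmin⟩ :=
        (InvImage.wf (fun γ : Fin 2 → ℤ => (γ 0 - α 0).toNat + (γ 1 - α 1).toNat)
          Nat.lt_wfRel.wf).has_min {γ | γ ∈ X ∧ α < γ ∧ γ ≤ β} ⟨β, hβ, hlt, le_rfl⟩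
      have h₁ := lt_iff_two.1 hαγ
      have h₂ := le_iff_two.1 hγβ
      obtain ⟨n, c, hc⟩ := ih _ (by omega) hγ hγβ rfl
      refine ⟨n + 1, _, hc.cons ⟨hα, hγ, hαγ, fun ε hε hlt' => ?_⟩⟩
      refine hmin ε ⟨hε, hlt'.1, hlt'.2.le.trans hγβ⟩ ?_
      have h₃ := lt_iff_two.1 hlt'.1
      have h₄ := lt_iff_two.1 hlt'.2
      simp only [InvImage, WellFoundedRelation.rel]
      omega

/-- The length of a saturated chain is the increase of the potential. -/
theorem IsSaturatedChain.potential_eq {X : Set (Fin 2 → ℤ)} (hX : PlaneGood (plane X))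
    {b c : ℤ} (hb : ∀ α ∈ X, b ≤ α 0 ∧ c ≤ α 1) {α β : Fin 2 → ℤ} {n : ℕ} {f : ℕ → Fin 2 → ℤ}
    (hf : IsSaturatedChain X α β n f) :
    potential (plane X) b c (β 0) (β 1) = potential (plane X) b c (α 0) (α 1) + n := by
  have key : ∀ i ≤ n, potential (plane X) b c (f i 0) (f i 1)
      = potential (plane X) b c (α 0) (α 1) + i := by
    intro i
    induction i with
    | zero => intro _; simp [hf.head]
    | succ i ih =>
      intro hi
      obtain ⟨h₁, h₂, hlt, hcons⟩ := hf.consecutive i (by omega)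
      have hlt' := lt_iff_two.1 hlt
      rw [hX.potential_consecutive (hb _ h₁).1 (hb _ h₁).2 (plane_iff.2 h₁) (plane_iff.2 h₂)
        hlt'.1.1 hlt'.1.2 hlt'.2, ih (by omega)]
      · push_cast; ring
      · intro u v huv hu hu' hv hv' h₃ h₄
        exact hcons _ huv ⟨lt_iff_two.2 ⟨⟨hu, hv⟩, h₃⟩, lt_iff_two.2 ⟨⟨hu', hv'⟩, h₄⟩⟩
  simpa [hf.last] using key n le_rfl

theorem exists_hasChainDist {X : Set (Fin 2 → ℤ)} (hX : PlaneGood (plane X))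
    {b c : ℤ} (hb : ∀ α ∈ X, b ≤ α 0 ∧ c ≤ α 1) {α β : Fin 2 → ℤ} (hα : α ∈ X) (hβ : β ∈ X)
    (hle : α ≤ β) : ∃ n : ℕ, HasChainDist X α β n ∧
      potential (plane X) b c (β 0) (β 1) = potential (plane X) b c (α 0) (α 1) + n := by
  obtain ⟨n, f, hf⟩ := exists_isSaturatedChain X hα hβ hle
  have h := hf.potential_eq hX hb
  refine ⟨n, ⟨⟨f, hf⟩, fun m g hg => ?_⟩, h⟩
  have h' := hg.potential_eq hX hb
  omega

/-! ### The levels as fibres of the gap potential -/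

section Levels

variable {P Q : ℤ → ℤ → Prop} {b c d e : ℤ} {n : ℤ → ℤ → ℤ} {A : Set (Fin 2 → ℤ)}

/-- The elements left after `k` steps are those of potential larger than `k`, and those removed
in the next step are those of potential `k + 1`. -/
theorem IsGapPotential.remaining_D (h : IsGapPotential P Q b c d e n)
    (hA : ∀ α, α ∈ A ↔ P (α 0) (α 1) ∧ ¬ Q (α 0) (α 1)) (k : ℕ) :
    (remaining A k = {α | α ∈ A ∧ (k : ℤ) < n (α 0) (α 1)}) ∧
      D A (k + 1) = {α | α ∈ A ∧ n (α 0) (α 1) = k + 1} := by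
  have step : ∀ k : ℕ, remaining A k = {α | α ∈ A ∧ (k : ℤ) < n (α 0) (α 1)} →
      D A (k + 1) = {α | α ∈ A ∧ n (α 0) (α 1) = k + 1} := by
    intro k hk
    have hD : D A (k + 1) =
      maximalPart (remaining A k) \ minPart (maximalPart (remaining A k)) := rfl
    have hmax : ∀ α ∈ maximalPart (remaining A k), ∀ β ∈ remaining A k, ¬ LL α β := by
      intro α hα β hβ hlt
      have := hα.2 β hβ (Or.inr hlt)
      subst this
      exact lt_irrefl _ hlt.1
    have hmax' : ∀ α ∈ remaining A k, (∀ β ∈ remaining A k, ¬ LL α β) →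
        α ∈ maximalPart (remaining A k) := by
      refine fun α hα hno => ⟨hα, fun β hβ hlt => ?_⟩
      rcases hlt with rfl | hlt
      · rfl
      · exact absurd hlt (hno β hβ)
    ext α
    rw [hD]
    constructor
    · rintro ⟨hB, hC⟩
      have hr := hB.1
      rw [hk] at hr
      obtain ⟨hαA, hlt⟩ := hr
      refine ⟨hαA, le_antisymm ?_ (by omega)⟩
      by_contra! hlt'
      rcases h.exists_of_lt ((hA α).1 hαA).1 (by omega) hlt' with
        ⟨x, y, hx, hy, hP, hQ, hn⟩ | ⟨x, y, hx, hy, ⟨hP₁, hQ₁, hn₁⟩, hP₂, hQ₂, hn₂⟩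
      · refine hmax α hB ![x, y] ?_ ⟨hx, hy⟩
        rw [hk]
        exact ⟨(hA _).2 ⟨hP, hQ⟩, by simpa using hn⟩
      -- Whatever lies strictly above either of the two points in both coordinates also lies so
      -- above `α`, so both inherit maximality.
      · have hm₁ : ![x, α 1] ∈ maximalPart (remaining A k) := by
          refine hmax' _ ?_ fun β hβ hlt => hmax α hB β hβ ⟨hx.trans hlt.1, hlt.2⟩
          rw [hk]
          exact ⟨(hA _).2 ⟨hP₁, hQ₁⟩, by simpa using hn₁⟩
        have hm₂ : ![α 0, y] ∈ maximalPart (remaining A k) := by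
          refine hmax' _ ?_ fun β hβ hlt => hmax α hB β hβ ⟨hlt.1, hy.trans hlt.2⟩
          rw [hk]
          exact ⟨(hA _).2 ⟨hP₂, hQ₂⟩, by simpa using hn₂⟩
        refine hC ⟨hB, ![x, α 1], ⟨hm₁, fun heq => ?_⟩, ![α 0, y], ⟨hm₂, fun heq => ?_⟩, ?_⟩
        · exact hx.ne' (congrFun heq 0)
        · exact hy.ne' (congrFun heq 1)
        · rw [eq_iff_two]
          simp [hx.le, hy.le]
    · rintro ⟨hαA, hn⟩
      obtain ⟨hP, hQ⟩ := (hA α).1 hαA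
      refine ⟨hmax' α (by rw [hk]; exact ⟨hαA, by omega⟩) fun β hβ hlt => ?_, ?_⟩
      · rw [hk] at hβ
        have := h.lt_of_lt hP hQ hlt.1 hlt.2
        have := hβ.2
        omega
      · rintro ⟨-, β, ⟨hβ, hβα⟩, γ, ⟨hγ, hγα⟩, heq⟩
        have hβ' := hβ.1
        have hγ' := hγ.1
        rw [hk] at hβ' hγ'
        have h₀ : α 0 = min (β 0) (γ 0) := congrFun heq 0
        have h₁ : α 1 = min (β 1) (γ 1) := congrFun heq 1
        have h₂ : ¬ (β 0 = α 0 ∧ β 1 = α 1) := fun h => hβα (eq_iff_two.2 h)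
        have h₃ : ¬ (γ 0 = α 0 ∧ γ 1 = α 1) := fun h => hγα (eq_iff_two.2 h)
        have hnβ := hβ'.2
        have hnγ := hγ'.2
        -- As neither point is `α`, one lies directly above `α` and the other directly to its right.
        rcases le_total (β 0) (γ 0) with h₄ | h₄
        · have h₅ : β 0 = α 0 := by omega
          have h₆ : γ 1 = α 1 := by omega
          rw [h₅] at hnβ
          rw [h₆] at hnγ
          exact h.false_of_inf hP hQ (x' := γ 0) (y' := β 1) (by omega) (by omega) (by omega)
            (by omega)
        · have h₅ : γ 0 = α 0 := by omega
          have h₆ : β 1 = α 1 := by omega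
          rw [h₅] at hnγ
          rw [h₆] at hnβ
          exact h.false_of_inf hP hQ (x' := β 0) (y' := γ 1) (by omega) (by omega) (by omega)
            (by omega)
  have hrem : remaining A k = {α | α ∈ A ∧ (k : ℤ) < n (α 0) (α 1)} := by
    induction k with
    | zero =>
      ext α
      refine ⟨fun hα => ⟨hα, ?_⟩, fun hα => hα.1⟩
      simpa using h.pos ((hA α).1 hα).1 ((hA α).1 hα).2
    | succ k ih =>
      have : remaining A (k + 1) = remaining A k \ D A (k + 1) := rfl
      rw [this, step k ih, ih]
      ext α
      simp only [Set.mem_sdiff, Set.mem_ofPred_eq]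
      constructor
      · rintro ⟨⟨h₁, h₂⟩, h₃⟩
        refine ⟨h₁, lt_of_le_of_ne (by push_cast; omega) fun heq => h₃ ⟨h₁, ?_⟩⟩
        push_cast at heq
        exact heq.symm
      · rintro ⟨h₁, h₂⟩
        push_cast at h₂
        exact ⟨⟨h₁, by omega⟩, fun h₃ => by omega⟩
  exact ⟨hrem, step k hrem⟩

/-- The number of levels is the potential at the base point. -/
theorem IsGapPotential.hasNumLevels (h : IsGapPotential P Q b c d e n)
    (hA : ∀ α, α ∈ A ↔ P (α 0) (α 1) ∧ ¬ Q (α 0) (α 1)) {N : ℕ} (hN : n b c = N) :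
    HasNumLevels A N := by
  have hlev : ∀ i ∈ Set.Icc 1 N, level A N i = {α | α ∈ A ∧ n (α 0) (α 1) = N + 1 - i} := by
    rintro i ⟨hi, hiN⟩
    have heq : N + 1 - i = (N - i) + 1 := by omega
    rw [level, heq, (h.remaining_D hA _).2]
    push_cast [hiN]
    ring_nf
  refine ⟨?_, ?_, ?_⟩
  · ext α
    simp only [Set.mem_iUnion]
    constructor
    · intro hα
      obtain ⟨hP, hQ⟩ := (hA α).1 hα
      obtain ⟨hb, hc⟩ := h.base hP
      have h₁ := h.pos hP hQ
      have h₂ := h.anti le_rfl le_rfl hb hc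
      -- Levels are numbered in reverse: value `k` is level `N + 1 - k`, and `0 < k ≤ N` as `n` is
      -- antitone from `(b, c)`.
      have hi : N + 1 - (n (α 0) (α 1)).toNat ∈ Set.Icc 1 N := ⟨by omega, by omega⟩
      refine ⟨_, hi, ?_⟩
      rw [hlev _ hi]
      exact ⟨hα, by omega⟩
    · rintro ⟨i, hi, hα⟩
      rw [hlev i hi] at hα
      exact hα.1
  · intro i hi j hj hij
    rw [Function.onFun, hlev i hi, hlev j hj, Set.disjoint_left]
    rintro α ⟨-, h₁⟩ ⟨-, h₂⟩
    omega
  · intro i hi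
    obtain ⟨x, y, hx, hy, hn⟩ := h.exists_value (k := (N : ℤ) + 1 - i) le_rfl le_rfl
      (by have := hi.2; omega) (by have := hi.1; omega)
    obtain ⟨x', y', -, -, hP, hQ, hn'⟩ := h.exists_eq hx hy (by have := hi.2; omega)
    rw [hlev i hi]
    exact ⟨![x', y'], (hA _).2 ⟨hP, hQ⟩, by simpa using hn'.trans hn⟩

end Levels

/-! ### Assembly: levels and distance as the same value -/

/-- The difference of two potentials is a gap potential. -/
theorem isGapPotential_potential {P Q : ℤ → ℤ → Prop} {b c d e : ℤ} (hP : PlaneGood P)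
    (hQ : PlaneGood Q) (hbase : ∀ {x y}, P x y → b ≤ x ∧ c ≤ y) (hsub : ∀ {x y}, Q x y → P x y)
    (hbig : ∀ {x y}, d ≤ x → e ≤ y → Q x y) :
    IsGapPotential P Q b c d e fun x y => (potential P b c d e - potential Q b c d e)
      - (potential P b c x y - potential Q b c x y) where
  base := hbase
  sub := hsub
  good := hP
  good' := hQ
  big := hbig
  right hx hy := by
    rw [hP.potential_right hx hy, hQ.potential_right hx hy, gap_eq_sub fun _ _ => hsub]
    ring
  up {x y} hx hy := by
    rw [potential_up P b c x hy, potential_up Q b c x hy, gap_eq_sub fun _ _ => hsub]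
    ring
  zero := sub_self _

end GoodIdeals

/-- `NL(A) = d(I ∖ E)`, where `E = I ∖ A`: both numbers are well defined and they agree. -/
theorem mainTheorem9 (S : AddSubmonoid (Fin 2 → ℤ)) (hS : GoodIdeals.IsGoodSemigroup S)
    (I A : Set (Fin 2 → ℤ)) (hI : GoodIdeals.IsRelativeGoodIdeal S I) (hA : A ⊆ I)
    (hE : GoodIdeals.IsRelativeGoodIdeal S (I \ A)) :
    ∃ N : ℕ, GoodIdeals.HasNumLevels A N ∧ GoodIdeals.HasDistance I (I \ A) (N : ℤ) := by
  open GoodIdeals in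
  obtain ⟨b, hb⟩ := exists_isLeast hI.g1 hI.nonempty (hI.toIsRelativeIdeal.bddBelow hS)
  obtain ⟨f, hf⟩ := exists_isLeast hE.g1 hE.nonempty (hE.toIsRelativeIdeal.bddBelow hS)
  obtain ⟨δ, hδ⟩ := hE.toIsRelativeIdeal.exists_bigEnough hS
  have hP := planeGood hI.g1 hI.g3
  have hQ := planeGood hE.g1 hE.g3
  have hbI : ∀ α ∈ I, b 0 ≤ α 0 ∧ b 1 ≤ α 1 := fun α hα => le_iff_two.1 (hb.2 hα)
  have hpot := isGapPotential_potential (b := b 0) (c := b 1) (d := δ 0) (e := δ 1) hP hQ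
    (fun h => hbI _ h) (fun h => h.1) (fun hx hy => hδ _ (le_iff_two.2 ⟨hx, hy⟩))
  obtain ⟨N, hN⟩ := Int.eq_ofNat_of_zero_le (hpot.nonneg le_rfl le_rfl)
  have hmemA : ∀ α, α ∈ A ↔ plane I (α 0) (α 1) ∧ ¬ plane (I \ A) (α 0) (α 1) := by
    intro α
    rw [plane_iff, plane_iff]
    exact ⟨fun h => ⟨hA h, fun h' => h'.2 h⟩, fun h => by_contra fun h' => h.2 ⟨h.1, h'⟩⟩
  refine ⟨N, hpot.hasNumLevels hmemA hN, b, f, hb, hf,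
    ⟨δ, fun β hβ => ⟨(hδ β hβ).1, hδ β hβ⟩⟩, fun α hα => ?_⟩
  have hαm := hα α le_rfl
  obtain ⟨p, hp, hp'⟩ := exists_hasChainDist hP hbI hb.1 hαm.1 (hb.2 hαm.1)
  obtain ⟨q, hq, hq'⟩ := exists_hasChainDist hQ (fun β hβ => hbI β hβ.1) hf.1 hαm.2
    (hf.2 hαm.2)
  refine ⟨p, q, hp, hq, ?_⟩
  have hpot' := isGapPotential_potential (b := b 0) (c := b 1) (d := α 0) (e := α 1) hP hQ
    (fun h => hbI _ h) (fun h => h.1) (fun hx hy => (hα _ (le_iff_two.2 ⟨hx, hy⟩)).2)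
  -- Both gap potentials vanish at the join of `δ` and `α`, so replacing `δ` by `α` does not change
  -- the difference of the potentials.
  have h₁ := hpot.eq_zero (x := max (δ 0) (α 0)) (y := max (δ 1) (α 1)) (le_max_left _ _)
    (le_max_left _ _)
  have h₂ := hpot'.eq_zero (x := max (δ 0) (α 0)) (y := max (δ 1) (α 1)) (le_max_right _ _)
    (le_max_right _ _)
  have h₃ := hQ.potential_least (hbI f hf.1.1).1 (hbI f hf.1.1).2
    fun u v h => le_iff_two.1 (hf.2 h)
  rw [potential_base] at hp'
  rw [h₃] at hq'
  simp only [potential_base] at hN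
  omega
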